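/- A first-order structure $M$ is called \emph{homomorphism-homogeneous} if every homomorphism $B\to C$ between finitely generated substructures $B,C$ of $M$ extends to an endomorphism of $M$. (Homomorphisms preserve the operations and constants and map related tuples to related tuples.) The \emph{Fraïssé limit} of a class $\mathcal C$ of finitely generated structures is a countable structure $M$ such that the finitely generated structures embeddable into $M$ are exactly the members of $\mathcal C$, and such that every isomorphism between finitely generated substructures of $M$ extends to an automorphism of $M$; it is unique up to isomorphism. In languages without constant symbols the empty structure is counted among the finite structures. Each of the following structures is homomorphism-homogeneous: \begin{enumerate} \item the random graph $R$, i.e. the Fraïssé limit of the class of all finite simple graphs; \item for every $n\ge 3$, the complement $\overline{H_n}$ of the Henson graph $H_n$, where $H_n$ is the Fraïssé limit of the class of all finite simple graphs containing no clique on $n$ vertices; \item the rational Urysohn space $\mathbb U_{\mathbb Q}$, i.e. the Fraïssé limit of the class of all finite metric spaces with rational distances, where a metric space is regarded as a relational structure with binary relations $R_\alpha=\{(x,y): d(x,y)\le\alpha\}$ for rational $\alpha\ge 0$ (so that homomorphisms are exactly the non-expanding maps); \item the generic poset $\mathbb P$, i.e. the Fraïssé limit of the class of all finite posets, in the language $\{\le\}$;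 \item the Fraïssé limit $\Omega$ of the class of all finite semilattices, in the language with one binary operation; \item the Fraïssé limit $\mathbb D$ of the class of all finite distributive lattices, in the language $\{\vee,\wedge\}$; \item the countable atomless Boolean algebra $\mathbb A$, i.e. the Fraïssé limit of the class of all finite Boolean algebras with $0\ne 1$, in the language $\{\vee,\wedge,{}',0,1\}$; \item for every field $\mathbb F$, the $\aleph_0$-dimensional vector space $V_\infty^{\mathbb F}$ over $\mathbb F$, in the language of $\mathbb F$-vector spaces (addition, negation, zero and multiplication by each scalar). \end{enumerate} -/

import Mathlib

open FirstOrder CategoryTheory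
open scoped Cardinal

universe u v w

namespace HomHom

/-- A structure `M` is homomorphism-homogeneous if every homomorphism between finitely generated
substructures of `M` extends to an endomorphism of `M`. -/
def IsHomomorphismHomogeneous (L : FirstOrder.Language.{u, v}) (M : Type w) [L.Structure M] : Prop :=
  ∀ (B C : L.Substructure M), B.FG → C.FG → ∀ φ : B →[L] C,
    ∃ ψ : M →[L] M, ∀ b : B, ψ (b : M) = (φ b : M)

/-! ### Graphs -/

/-- The class of all finite simple graphs, in the language of one binary relation (adjacency). -/
def finiteGraphs : Set (Bundled.{u} FirstOrder.Language.graph.Structure) :=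
  {S | Finite S ∧ ∃ G : SimpleGraph S, S.str = G.structure}

/-- The class of all finite simple graphs without a clique on `n` vertices. -/
def finiteCliqueFreeGraphs (n : ℕ) : Set (Bundled.{u} FirstOrder.Language.graph.Structure) :=
  {S | Finite S ∧ ∃ G : SimpleGraph S, G.CliqueFree n ∧ S.str = G.structure}

/-! ### Posets -/

/-- The class of all finite posets, in the language of one binary relation `≤`. -/
def finitePosets : Set (Bundled.{u} FirstOrder.Language.order.Structure) :=
  {S | Finite S ∧ ∃ P : PartialOrder S, S.str = @FirstOrder.Language.orderStructure S P.toLE}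

/-! ### Metric spaces with rational distances -/

/-- The relation symbols of the language of rational metric spaces: a binary symbol
`distLE α` for each non-negative rational `α`. -/
inductive MetricRel : ℕ → Type
  | distLE (α : ℚ≥0) : MetricRel 2

/-- The language of rational metric spaces. -/
def metricLanguage : FirstOrder.Language.{0, 0} := ⟨fun _ => Empty, MetricRel⟩

instance : Countable (Σ l, metricLanguage.Functions l) :=
  inferInstanceAs (Countable (Σ _ : ℕ, Empty))

/-- A metric space as a relational structure: `distLE α` holds of `(x, y)` iff
`dist x y ≤ α`. -/
@[reducible]
def metricStructure (X : Type u) (_ : MetricSpace X) : metricLanguage.Structure X where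
  funMap := fun f => nomatch f
  RelMap | .distLE α => fun x => dist (x 0) (x 1) ≤ (α : ℝ)

/-- The class of all finite metric spaces in which all distances are rational. -/
def finiteRationalMetricSpaces : Set (Bundled.{u} metricLanguage.Structure) :=
  {S | Finite S ∧ ∃ m : MetricSpace S,
    (∀ x y : S, ∃ q : ℚ, dist x y = (q : ℝ)) ∧ S.str = metricStructure S m}

/-! ### Semilattices -/

/-- The function symbols of the language of semilattices: one binary symbol. -/
inductive SemilatticeFunc : ℕ → Type
  | inf : SemilatticeFunc 2

/-- The language of semilattices. -/
def semilatticeLanguage : FirstOrder.Language.{0, 0} := ⟨SemilatticeFunc, fun _ => Empty⟩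

instance : Countable (Σ l, semilatticeLanguage.Functions l) :=
  Function.Injective.countable (β := Unit) (f := fun _ => ()) (by
    rintro ⟨_, ⟨⟩⟩ ⟨_, ⟨⟩⟩ _; rfl)

/-- A semilattice as an algebra with one binary operation. -/
@[reducible]
def semilatticeStructure (X : Type u) (_ : SemilatticeInf X) :
    semilatticeLanguage.Structure X where
  funMap | .inf => fun x => x 0 ⊓ x 1
  RelMap := fun r => nomatch r

/-- The class of all finite semilattices. -/
def finiteSemilattices : Set (Bundled.{u} semilatticeLanguage.Structure) :=
  {S | Finite S ∧ ∃ h : SemilatticeInf S, S.str = semilatticeStructure S h}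

/-! ### Distributive lattices -/

/-- The function symbols of the language of lattices: two binary symbols. -/
inductive LatticeFunc : ℕ → Type
  | sup : LatticeFunc 2
  | inf : LatticeFunc 2

/-- The language of lattices. -/
def latticeLanguage : FirstOrder.Language.{0, 0} := ⟨LatticeFunc, fun _ => Empty⟩

instance : Countable (Σ l, latticeLanguage.Functions l) :=
  Function.Injective.countable (β := Bool)
    (f := fun | ⟨_, .sup⟩ => true | ⟨_, .inf⟩ => false) (by
    rintro ⟨_, ⟨⟩⟩ ⟨_, ⟨⟩⟩ h <;> simp_all)

/-- A lattice as an algebra with the binary operations `⊔`, `⊓`. -/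
@[reducible]
def latticeStructure (X : Type u) (_ : Lattice X) : latticeLanguage.Structure X where
  funMap
    | .sup => fun x => x 0 ⊔ x 1
    | .inf => fun x => x 0 ⊓ x 1
  RelMap := fun r => nomatch r

/-- The class of all finite distributive lattices (bounds are not named in the language). -/
def finiteDistribLattices : Set (Bundled.{u} latticeLanguage.Structure) :=
  {S | Finite S ∧ ∃ h : DistribLattice S, S.str = latticeStructure S h.toLattice}

/-! ### Boolean algebras -/

/-- The function symbols of the language of Boolean algebras. -/
inductive BooleanFunc : ℕ → Type
  | sup : BooleanFunc 2
  | inf : BooleanFunc 2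
  | compl : BooleanFunc 1
  | bot : BooleanFunc 0
  | top : BooleanFunc 0

/-- The language of Boolean algebras. -/
def booleanLanguage : FirstOrder.Language.{0, 0} := ⟨BooleanFunc, fun _ => Empty⟩

instance : Countable (Σ l, booleanLanguage.Functions l) :=
  Function.Injective.countable (β := ℕ)
    (f := fun | ⟨_, .sup⟩ => 0 | ⟨_, .inf⟩ => 1 | ⟨_, .compl⟩ => 2 | ⟨_, .bot⟩ => 3
              | ⟨_, .top⟩ => 4) (by
    rintro ⟨_, ⟨⟩⟩ ⟨_, ⟨⟩⟩ h <;> simp_all)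

/-- A Boolean algebra as an algebra with operations `⊔`, `⊓`, `ᶜ`, `⊥`, `⊤`. -/
@[reducible]
def booleanStructure (X : Type u) (_ : BooleanAlgebra X) : booleanLanguage.Structure X where
  funMap
    | .sup => fun x => x 0 ⊔ x 1
    | .inf => fun x => x 0 ⊓ x 1
    | .compl => fun x => (x 0)ᶜ
    | .bot => fun _ => ⊥
    | .top => fun _ => ⊤
  RelMap := fun r => nomatch r

/-- The class of all finite Boolean algebras with `0 ≠ 1`. (The one-element Boolean algebra
embeds in no other one, so it cannot belong to a class with the joint embedding property that
contains a larger algebra.) -/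
def finiteBooleanAlgebras : Set (Bundled.{u} booleanLanguage.Structure) :=
  {S | Finite S ∧ Nontrivial S ∧ ∃ h : BooleanAlgebra S, S.str = booleanStructure S h}

/-! ### Vector spaces -/

/-- The function symbols of the language of vector spaces over `F`: addition, negation, zero and
a unary symbol for each scalar. -/
inductive VectorFunc (F : Type u) : ℕ → Type u
  | add : VectorFunc F 2
  | neg : VectorFunc F 1
  | zero : VectorFunc F 0
  | smul (c : F) : VectorFunc F 1

/-- The language of vector spaces over `F`. -/
def vectorLanguage (F : Type u) : FirstOrder.Language.{u, 0} := ⟨VectorFunc F, fun _ => Empty⟩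

/-- A vector space over `F` as an algebra in the language of vector spaces over `F`. -/
@[reducible]
def vectorStructure (F : Type u) (V : Type w) [Field F] [AddCommGroup V] [Module F V] :
    (vectorLanguage F).Structure V where
  funMap
    | .add => fun x => x 0 + x 1
    | .neg => fun x => - x 0
    | .zero => fun _ => 0
    | .smul c => fun x => c • x 0
  RelMap := fun r => nomatch r

end HomHom

namespace HomHom

open FirstOrder.Language FirstOrder.Language.Structure FirstOrder.Language.Substructure

variable {L : FirstOrder.Language.{u, v}} {M : Type w} [L.Structure M]

/-! In a countable structure an endomorphism is the union of a chain of homomorphisms with finitely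
generated domains, so everything reduces to adding one point to the domain. In a Fraïssé limit this
follows from an amalgamation of a homomorphism `A → T` with an inclusion `A ≤ S`: some `D` in the
class contains `T` and receives a compatible homomorphism from `S`, and ultrahomogeneity then places
`D` in the limit over `T`.

The amalgams are explicit. A graph only needs a vertex joined to a given finite set. For metric
spaces, one point is added to `T` at shortest-path distances. For posets and semilattices, `D` is
the completion of `T` by lower sets. For distributive lattices and Boolean algebras, `D` is the
power set of the set of homomorphisms from `T` to `Prop`, and the prime ideal theorem extends each
coordinate. For vector spaces, linear maps extend from subspaces directly. -/

/-- In a countable structure it suffices to extend homomorphisms from finitely generated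
substructures one element at a time. -/
theorem isHomomorphismHomogeneous_of_onePointExtension [Countable M]
    (step : ∀ A : L.Substructure M, A.FG → ∀ (f : A →[L] M) (x : M),
      ∃ A' : L.Substructure M, A'.FG ∧ x ∈ A' ∧ ∃ (h : A ≤ A') (g : A' →[L] M),
        ∀ a : A, g (inclusion h a) = f a) :
    IsHomomorphismHomogeneous L M := by
  intro B C hB _ φ
  rcases isEmpty_or_nonempty M with hM | hM
  · exact ⟨Hom.id L M, fun b => isEmptyElim (b : M)⟩
  obtain ⟨e, he⟩ := exists_surjective_nat M
  let Q := Σ A : {A : L.Substructure M // A.FG}, (A.1 →[L] M)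
  have step' : ∀ (q : Q) (x : M), ∃ q' : Q, x ∈ q'.1.1 ∧ ∃ h : q.1.1 ≤ q'.1.1,
      ∀ a : q.1.1, q'.2 (inclusion h a) = q.2 a := by
    rintro ⟨⟨A, hA⟩, f⟩ x
    obtain ⟨A', hA', hx, h, g, hg⟩ := step A hA f x
    exact ⟨⟨⟨A', hA'⟩, g⟩, hx, h, hg⟩
  choose next hmem hle heq using step'
  -- The point `e n` enters the domain at stage `n + 1`, so the domains exhaust `M`.
  let s : ℕ → Q := fun n => Nat.rec ⟨⟨B, hB⟩, C.subtype.toHom.comp φ⟩ (fun n q => next q (e n)) n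
  have hs : ∀ n, s (n + 1) = next (s n) (e n) := fun n => rfl
  have mono : ∀ n k, ∃ h : (s n).1.1 ≤ (s (n + k)).1.1,
      ∀ a : (s n).1.1, (s (n + k)).2 (inclusion h a) = (s n).2 a := by
    intro n k
    induction k with
    | zero => exact ⟨le_rfl, fun a => rfl⟩
    | succ k ih =>
      obtain ⟨h, hh⟩ := ih
      refine ⟨h.trans (hle (s (n + k)) (e (n + k))), fun a => ?_⟩
      rw [← hh a]
      exact heq (s (n + k)) (e (n + k)) (inclusion h a)
  have agree : ∀ n m (x : M) (hn : x ∈ (s n).1.1) (hm : x ∈ (s m).1.1),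
      (s n).2 ⟨x, hn⟩ = (s m).2 ⟨x, hm⟩ := by
    intro n m x hn hm
    rcases le_total n m with h | h
    · obtain ⟨k, rfl⟩ := Nat.exists_eq_add_of_le h
      exact ((mono n k).2 ⟨x, hn⟩).symm
    · obtain ⟨k, rfl⟩ := Nat.exists_eq_add_of_le h
      exact (mono m k).2 ⟨x, hm⟩
  have cover : ∀ x : M, ∃ n, x ∈ (s n).1.1 := by
    intro x
    obtain ⟨n, rfl⟩ := he x
    exact ⟨n + 1, hmem (s n) (e n)⟩
  choose N hN using cover
  -- Preservation of functions and relations concerns finite tuples, each of which lies in a single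
  -- stage.
  have common : ∀ {n : ℕ} (x : Fin n → M), ∃ m, ∀ i, x i ∈ (s m).1.1 := by
    intro n x
    refine ⟨Finset.univ.sup fun i => N (x i), fun i => ?_⟩
    have hi : N (x i) ≤ Finset.univ.sup fun i => N (x i) :=
      Finset.le_sup (f := fun i => N (x i)) (Finset.mem_univ i)
    obtain ⟨k, hk⟩ := Nat.exists_eq_add_of_le hi
    rw [hk]
    exact (mono _ k).1 (hN (x i))
  let ψ : M → M := fun x => (s (N x)).2 ⟨x, hN x⟩
  have hψ : ∀ m x (hx : x ∈ (s m).1.1), ψ x = (s m).2 ⟨x, hx⟩ := fun m x hx => agree _ _ _ _ _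
  refine ⟨⟨ψ, ?_, ?_⟩, fun b => hψ 0 b b.2⟩
  · intro n f x
    obtain ⟨m, hm⟩ := common x
    have h1 := (s m).2.map_fun f (fun i => ⟨x i, hm i⟩)
    have h2 : ψ ∘ x = (s m).2 ∘ fun i => ⟨x i, hm i⟩ := funext fun i => hψ m _ (hm i)
    rw [h2, ← h1]
    exact hψ m _ _
  · intro n r x hr
    obtain ⟨m, hm⟩ := common x
    have h2 : ψ ∘ x = (s m).2 ∘ fun i => ⟨x i, hm i⟩ := funext fun i => hψ m _ (hm i)
    rw [h2]
    exact (s m).2.map_rel r (fun i => ⟨x i, hm i⟩) hr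

/-- A Fraïssé limit of `K` is homomorphism-homogeneous if every homomorphism `f : A →[L] T`,
where `T` and a one-point extension `S` of `A` belong to `K`, extends to a homomorphism from `S`
to an extension of `T` within `K`. -/
theorem isHomomorphismHomogeneous_of_isFraisseLimit [Countable (Σ l, L.Functions l)] [Countable M]
    {K : Set (Bundled.{w} L.Structure)} (hM : IsFraisseLimit K M)
    (ext : ∀ S ∈ K, ∀ T ∈ K, ∀ (A : L.Substructure S) (x : S),
      closure L (insert x (A : Set S)) = ⊤ → ∀ f : A →[L] T,
      ∃ D ∈ K, ∃ (i : T ↪[L] D) (g : S →[L] D), ∀ a : A, g a = i (f a)) :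
    IsHomomorphismHomogeneous L M := by
  refine isHomomorphismHomogeneous_of_onePointExtension fun B hB φ x => ?_
  set S := closure L (insert x (B : Set M)) with hS
  have hSFG : S.FG := by
    rw [hS, closure_insert, closure_eq]
    exact (fg_closure_singleton x).sup hB
  have hBS : B ≤ S := fun b hb => subset_closure (Set.mem_insert_of_mem x hb)
  have hxS : x ∈ S := subset_closure (Set.mem_insert x _)
  -- The range, unlike all of `M`, is finitely generated and so belongs to `K`.
  have hTFG : φ.range.FG := ((fg_iff_structure_fg B).1 hB).range φ
  let A : L.Substructure S := B.comap S.subtype.toHom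
  have hA : closure L (insert ⟨x, hxS⟩ (A : Set S)) = ⊤ := by
    apply map_injective_of_injective (f := S.subtype.toHom) S.subtype.injective
    rw [map_closure, ← Hom.range_eq_map, range_subtype]
    refine Eq.trans (congrArg _ ?_) hS.symm
    ext y
    simp only [Set.mem_image, Set.mem_insert_iff]
    constructor
    · rintro ⟨z, rfl | hz, rfl⟩
      · exact Or.inl rfl
      · exact Or.inr hz
    · rintro (rfl | hy)
      · exact ⟨⟨y, hxS⟩, Or.inl rfl, rfl⟩
      · exact ⟨⟨y, hBS hy⟩, Or.inr hy, rfl⟩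
  let f : A →[L] φ.range := (φ.codRestrict φ.range fun b => φ.mem_range_self b).comp
    ((S.subtype.toHom.comp A.subtype.toHom).codRestrict B fun a => a.2)
  have hSK : (⟨S, inferInstance⟩ : Bundled.{w} L.Structure) ∈ K := hM.age ▸ age.fg_substructure hSFG
  have hTK : (⟨φ.range, inferInstance⟩ : Bundled.{w} L.Structure) ∈ K :=
    hM.age ▸ age.fg_substructure hTFG
  obtain ⟨D, hD, i, g, hg⟩ := ext _ hSK _ hTK A ⟨x, hxS⟩ hA f
  rw [← hM.age] at hD
  -- `j` embeds `D` into `M` and is the inclusion on the copy of `φ.range`.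
  obtain ⟨j, hj⟩ := hM.ultrahomogeneous.extend_embedding ((fg_iff_structure_fg _).1 hTFG)
    (h := hD.2) φ.range.subtype i
  refine ⟨S, hSFG, hxS, hBS, j.toHom.comp g, fun b => ?_⟩
  have h1 := hg ⟨inclusion hBS b, b.2⟩
  have h2 := DFunLike.congr_fun hj (f ⟨inclusion hBS b, b.2⟩)
  refine (congrArg j h1).trans (h2.symm.trans ?_)
  rfl

/-! ### Graphs -/

/-- A new point may go to any common neighbour of the image: its edges are then preserved, and its
non-edges impose nothing. -/
theorem isHomomorphismHomogeneous_of_common_neighbor {V : Type w} [Countable V] (G : SimpleGraph V)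
    (hG : ∀ s : Set V, s.Finite → ∃ v, ∀ u ∈ s, G.Adj v u) :
    @IsHomomorphismHomogeneous Language.graph V G.structure := by
  classical
  let := G.structure
  refine isHomomorphismHomogeneous_of_onePointExtension fun A hA f x => ?_
  have : Finite A := hA.finite
  by_cases hx : x ∈ A
  · exact ⟨A, hA, hx, le_rfl, f, fun _ => rfl⟩
  obtain ⟨v, hv⟩ := hG (Set.range f) (Set.finite_range f)
  let A' : Language.graph.Substructure V := ⟨insert x (A : Set V), (nomatch ·)⟩
  have : Finite A' := (Set.toFinite (A : Set V)).insert x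
  refine ⟨A', .of_finite, Set.mem_insert x _, fun a ha => Set.mem_insert_of_mem x ha,
    ⟨fun z => if h : (z : V) ∈ A then f ⟨z, h⟩ else v, (nomatch ·), ?_⟩, fun a => dif_pos a.2⟩
  rintro _ ⟨⟩ z (hz : G.Adj (z 0) (z 1))
  change G.Adj (dite _ _ _) (dite _ _ _)
  have hfv : ∀ a, G.Adj v (f a) := fun a => hv _ ⟨a, rfl⟩
  split_ifs with h0 h1 h1
  · exact f.map_rel graphRel.adj ![⟨z 0, h0⟩, ⟨z 1, h1⟩] hz
  · exact (hfv _).symm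
  · exact hfv _
  · rw [(z 0).2.resolve_right h0, (z 1).2.resolve_right h1] at hz
    exact absurd hz (G.loopless.irrefl x)

/-- One-point extensions of finite induced subgraphs which belong to the age of a homogeneous
graph are realized in it. -/
theorem exists_vertex_of_isFraisseLimit {V : Type w} [Countable V] {G : SimpleGraph V}
    {K : Set (Bundled.{w} Language.graph.Structure)}
    (hG : @IsFraisseLimit Language.graph K V G.structure _ _) {s : Set V} (hs : s.Finite)
    {H : SimpleGraph (Option s)} (hK : ⟨Option s, H.structure⟩ ∈ K)
    (hH : ∀ a b : s, H.Adj (some a) (some b) ↔ G.Adj a b) :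
    ∃ v ∉ s, ∀ u : s, G.Adj v u ↔ H.Adj none (some u) := by
  let := G.structure
  let := H.structure
  let S : Language.graph.Substructure V := ⟨s, (nomatch ·)⟩
  have : Finite S := hs
  rw [← hG.age] at hK
  obtain ⟨j, hj⟩ := hG.ultrahomogeneous.extend_embedding (T := Option s) (.of_finite) (h := hK.2)
    S.subtype
    ⟨⟨some, Option.some_injective _⟩, (nomatch ·), by rintro _ ⟨⟩ x; exact hH (x 0) (x 1)⟩
  have hj' : ∀ u : s, j (some u) = u := fun u => (DFunLike.congr_fun hj u).symm
  refine ⟨j none, fun h => ?_, fun u => ?_⟩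
  · exact Option.some_ne_none _ (j.injective (hj' ⟨_, h⟩))
  · rw [← hj' u]
    exact j.map_rel graphRel.adj ![none, some u]

/-- Irreflexivity and symmetry involve at most two vertices, so they pass from the age to the limit.
-/
theorem exists_eq_simpleGraphStructure {R : Type w} [str : Language.graph.Structure R] [Countable R]
    (hR : IsFraisseLimit finiteGraphs.{w} R) : ∃ G : SimpleGraph R, str = G.structure := by
  have key : ∀ s : Set R, s.Finite → ∃ G : SimpleGraph s, ∀ a b : s,
      RelMap adj ![(a : R), b] ↔ G.Adj a b := by
    intro s hs
    let S : Language.graph.Substructure R := ⟨s, (nomatch ·)⟩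
    have : Finite S := hs
    have hS : (⟨S, inferInstance⟩ : Bundled.{w} Language.graph.Structure) ∈ finiteGraphs :=
      hR.age ▸ age.fg_substructure .of_finite
    obtain ⟨-, G, hG⟩ := hS
    refine ⟨G, fun a b => ?_⟩
    have h := congrArg (fun t : Language.graph.Structure S => t.RelMap adj ![a, b]) hG
    have e : ![(a : R), b] = fun i => ((![a, b] i : s) : R) := by
      ext i
      fin_cases i <;> rfl
    rw [e]
    exact iff_of_eq h
  have : R ⊨ Theory.simpleGraph := by
    rw [Theory.simpleGraph_model_iff]
    refine ⟨⟨fun x hx => ?_⟩, ⟨fun x y hxy => ?_⟩⟩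
    · obtain ⟨G, hG⟩ := key {x} (Set.finite_singleton x)
      exact G.loopless.irrefl _ ((hG ⟨x, rfl⟩ ⟨x, rfl⟩).1 hx)
    · obtain ⟨G, hG⟩ := key {x, y} (Set.toFinite _)
      exact (hG ⟨y, by simp⟩ ⟨x, by simp⟩).2 ((hG ⟨x, by simp⟩ ⟨y, by simp⟩).1 hxy).symm
  exact ⟨simpleGraphOfStructure R, structure_simpleGraphOfStructure.symm⟩

theorem isHomomorphismHomogeneous_randomGraph (R : Type w) [Language.graph.Structure R]
    [Countable R] (hR : IsFraisseLimit finiteGraphs.{w} R) :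
    IsHomomorphismHomogeneous Language.graph R := by
  obtain ⟨G, rfl⟩ := exists_eq_simpleGraphStructure hR
  refine isHomomorphismHomogeneous_of_common_neighbor G fun s hs => ?_
  have : Finite s := hs
  obtain ⟨v, -, hv⟩ := exists_vertex_of_isFraisseLimit hR hs
    -- Mapping to `Option s` leaves `none` isolated; complementing before and after keeps `G` on `s`
    -- and joins `none` to every vertex of `s`.
    (H := (((G.induce s)ᶜ).map Function.Embedding.some)ᶜ)
    ⟨inferInstanceAs (Finite (Option s)), _, rfl⟩ fun a b => by
      by_cases h : a = b <;> simp [SimpleGraph.map_adj', h]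
  exact ⟨v, fun u hu => (hv ⟨u, hu⟩).2 (by simp [SimpleGraph.map_adj'])⟩

theorem isHomomorphismHomogeneous_compl_henson (n : ℕ) (hn : 3 ≤ n) (V : Type w) [Countable V]
    (H : SimpleGraph V)
    (hH : @IsFraisseLimit Language.graph (finiteCliqueFreeGraphs.{w} n) V H.structure _ _) :
    @IsHomomorphismHomogeneous Language.graph V Hᶜ.structure := by
  have hfree : ∀ s : Set V, s.Finite → (H.induce s).CliqueFree n := by
    intro s hs
    let := H.structure
    let S : Language.graph.Substructure V := ⟨s, (nomatch ·)⟩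
    have : Finite S := hs
    have hS : (⟨S, inferInstance⟩ : Bundled.{w} Language.graph.Structure) ∈
      finiteCliqueFreeGraphs n := hH.age ▸ age.fg_substructure .of_finite
    obtain ⟨-, G, hG, hGS⟩ := hS
    refine hG.anti fun a b hab => ?_
    have h := congrArg (fun t : Language.graph.Structure S => t.RelMap adj ![a, b]) hGS
    exact h.mp hab
  refine isHomomorphismHomogeneous_of_common_neighbor Hᶜ fun s hs => ?_
  have : Finite s := hs
  obtain ⟨v, hvs, hv⟩ := exists_vertex_of_isFraisseLimit hH hs
    -- An isolated vertex lies in no clique of size at least 2, so adding `none` creates no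
    -- `n`-clique; it becomes a common neighbour in the complement.
    (H := (H.induce s).map Function.Embedding.some)
    ⟨inferInstanceAs (Finite (Option s)), _,
      fun t ht => by
        obtain ⟨t', ht', -⟩ := (SimpleGraph.isNClique_map_iff (by omega)).1 ht
        exact hfree s hs t' ht', rfl⟩
    fun a b => SimpleGraph.map_adj_apply (f := Function.Embedding.some)
  refine ⟨v, fun u hu => ⟨fun h => hvs (h ▸ hu), fun h => ?_⟩⟩
  simpa [SimpleGraph.map_adj'] using (hv ⟨u, hu⟩).1 h

/-! ### Metric spaces with rational distances -/

/-- The one-point extension of a metric space by a point with prescribed distances `r`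
to the given points. -/
@[reducible]
def optionMetricSpace {T : Type*} [MetricSpace T] (r : T → ℝ) (hpos : ∀ t, 0 < r t)
    (hr : ∀ s t, r s ≤ r t + dist s t) (hd : ∀ s t, dist s t ≤ r s + r t) :
    MetricSpace (Option T) where
  dist
    | none, none => 0
    | none, some t => r t
    | some t, none => r t
    | some s, some t => dist s t
  dist_self x := by cases x <;> simp
  dist_comm x y := by cases x <;> cases y <;> simp [dist_comm]
  dist_triangle x y z := by
    rcases x with _ | x <;> rcases y with _ | y <;> rcases z with _ | z
    · simp
    · simp
    · simpa using add_nonneg (hpos y).le (hpos y).le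
    · simpa [dist_comm] using hr z y
    · simp
    · exact hd x z
    · simpa [add_comm] using hr x y
    · exact dist_triangle x y z
  eq_of_dist_eq_zero {x y} h := by
    rcases x with _ | x <;> rcases y with _ | y
    · rfl
    · exact absurd h (hpos y).ne'
    · exact absurd h (hpos x).ne'
    · exact congrArg some (dist_eq_zero.1 h)

/-- The distances `r` of the one-point extension of `T` which amalgamates `S` and `T` along a
non-expanding map `f`, with the point `x` of `S` as the new point. -/
theorem exists_minimal_distance {S T : Type*} [MetricSpace S] [MetricSpace T] {A : Set S}
    [Finite A] [Nonempty A] {x : S} (hx : x ∉ A) {f : A → T} (hf : ∀ a b : A, dist (f a) (f b) ≤ dist (a : S) b) :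
    ∃ r : T → ℝ, (∀ t, 0 < r t) ∧ (∀ s t, r s ≤ r t + dist s t) ∧
      (∀ s t, dist s t ≤ r s + r t) ∧ (∀ a : A, r (f a) ≤ dist x a) ∧
      ∀ t, ∃ a : A, r t = dist x a + dist (f a) t := by
  -- `r t` is the length of a shortest route from `x` to `t` through `A`. The minimum is attained,
  -- which gives positivity here and later rationality.
  choose m hm using fun t => Finite.exists_min fun a : A => dist x a + dist (f a) t
  refine ⟨fun t => dist x (m t) + dist (f (m t)) t, fun t => ?_, fun s t => ?_, fun s t => ?_,
    fun a => ?_, fun t => ⟨m t, rfl⟩⟩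
  · have : 0 < dist x (m t) := dist_pos.2 fun h => hx (h ▸ (m t).2)
    positivity
  · have h1 := hm s (m t)
    have h2 := dist_triangle (f (m t)) t s
    rw [dist_comm t s] at h2
    linarith
  -- Go from `s` to `t` via `f (m s)` and `f (m t)`; the middle leg is at most the distance from `m
  -- s` to `m t`, hence at most the route through `x`.
  · have h1 := hf (m s) (m t)
    have h2 := dist_triangle_left (m s : S) (m t) x
    have h3 := dist_triangle4 s (f (m s)) (f (m t)) t
    rw [dist_comm s (f (m s))] at h3
    linarith
  · have h1 := hm (f a) a
    rwa [dist_self, add_zero] at h1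

theorem isHomomorphismHomogeneous_urysohn (U : Type w) [metricLanguage.Structure U] [Countable U]
    (hU : IsFraisseLimit finiteRationalMetricSpaces.{w} U) :
    IsHomomorphismHomogeneous metricLanguage U := by
  classical
  refine isHomomorphismHomogeneous_of_isFraisseLimit hU ?_
  rintro ⟨S, sS⟩ ⟨fS, pS, qS, hS⟩ ⟨T, sT⟩ ⟨hT, pT, qT, hT'⟩ A x hA f
  change Finite S at fS
  change Finite T at hT
  change MetricSpace S at pS
  change MetricSpace T at pT
  change ∀ x y : S, ∃ q : ℚ, dist x y = q at qS
  change ∀ x y : T, ∃ q : ℚ, dist x y = q at qT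
  change sS = metricStructure S pS at hS
  change sT = metricStructure T pT at hT'
  subst hS hT'
  let := metricStructure S pS
  let := metricStructure T pT
  -- Distances being rational, the relation indexed by the distance itself can be used.
  have nonexp : ∀ a b : A, dist (f a : T) (f b) ≤ dist (a : S) b := by
    intro a b
    obtain ⟨q, hq⟩ := qS a b
    have hq0 : 0 ≤ q := by exact_mod_cast hq ▸ dist_nonneg (x := (a : S))
    rw [hq]
    exact f.map_rel (MetricRel.distLE ⟨q, hq0⟩) ![a, b] hq.le
  -- Without function symbols closure adds nothing, so `S` is `A` together with `x`.
  have hmem : ∀ z : S, z = x ∨ z ∈ A := by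
    let A' : metricLanguage.Substructure S := ⟨insert x (A : Set S), (nomatch ·)⟩
    have h : closure metricLanguage (insert x (A : Set S)) ≤ A' := closure_le.2 le_rfl
    intro z
    rw [hA] at h
    exact h (mem_top z)
  by_cases hx : x ∈ A
  · have hz : ∀ z, z ∈ A := fun z => (hmem z).elim (fun h => h ▸ hx) id
    exact ⟨_, ⟨hT, pT, qT, rfl⟩, .refl _ _, f.comp ((Hom.id _ S).codRestrict A hz), fun a => rfl⟩
  -- No minimum exists over an empty `A`: then a constant map works, or `D = S` if `T` is also
  -- empty.
  rcases isEmpty_or_nonempty A with hAe | hAn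
  · rcases isEmpty_or_nonempty T with hTe | ⟨⟨t⟩⟩
    · exact ⟨⟨S, _⟩, ⟨fS, pS, qS, rfl⟩, ⟨.ofIsEmpty, (nomatch ·), fun r y => by
        obtain ⟨α⟩ := r
        exact isEmptyElim (y 0)⟩, .id _ _, isEmptyElim⟩
    · refine ⟨_, ⟨hT, pT, qT, rfl⟩, .refl _ _, ⟨fun _ => t, (nomatch ·), ?_⟩, isEmptyElim⟩
      rintro _ ⟨α⟩ y -
      exact (dist_self t).trans_le α.cast_nonneg
  obtain ⟨r, hpos, hr, hd, hrx, hrq⟩ := exists_minimal_distance (A := (A : Set S)) hx nonexp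
  let mD := optionMetricSpace r hpos hr hd
  let sD := metricStructure (Option T) mD
  have hq : ∀ t, ∃ q : ℚ, r t = q := by
    intro t
    obtain ⟨a, ha⟩ := hrq t
    obtain ⟨p, hp⟩ := qS x a
    obtain ⟨q, hq⟩ := qT (f a) t
    exact ⟨p + q, by rw [ha, hp, hq]; push_cast; rfl⟩
  refine ⟨⟨Option T, sD⟩, ⟨inferInstanceAs (Finite (Option T)), mD, ?_, rfl⟩,
    ⟨⟨some, Option.some_injective _⟩, (nomatch ·), ?_⟩,
    ⟨fun z => if h : z ∈ A then some (f ⟨z, h⟩) else none, (nomatch ·), ?_⟩, fun a => dif_pos a.2⟩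
  · rintro (_ | s) (_ | t)
    · exact ⟨0, by simp⟩
    · exact hq t
    · exact hq s
    · exact qT s t
  · rintro _ ⟨α⟩ y
    exact Iff.rfl
  · rintro _ ⟨α⟩ z (hz : dist (z 0) (z 1) ≤ α)
    refine le_trans ?_ hz
    change dist (dite _ _ _) (dite _ _ _) ≤ _
    split_ifs with h0 h1 h1
    · exact nonexp ⟨z 0, h0⟩ ⟨z 1, h1⟩
    · rw [dist_comm, (hmem (z 1)).resolve_right h1, dist_comm (z 0)]
      exact hrx ⟨z 0, h0⟩
    · rw [(hmem (z 0)).resolve_right h0]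
      exact hrx ⟨z 1, h1⟩
    · simp

/-! ### Posets and semilattices -/

instance {T : Type*} [LE T] [Finite T] : Finite (LowerSet T) :=
  Finite.of_injective (fun s : LowerSet T => (s : Set T)) SetLike.coe_injective

/-- The lower set generated by the values of `f` below `x`. -/
def lowerExtension {S T : Type*} [Preorder S] [Preorder T] (A : Set S) (f : A → T) (x : S) :
    LowerSet T where
  carrier := {t | ∃ a : A, (a : S) ≤ x ∧ t ≤ f a}
  lower' := fun _ _ hst ⟨a, ha, hs⟩ => ⟨a, ha, hst.trans hs⟩

theorem lowerExtension_mono {S T : Type*} [Preorder S] [Preorder T] (A : Set S) (f : A → T) :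
    Monotone (lowerExtension A f) :=
  fun _ _ hxy _ ⟨a, ha, ht⟩ => ⟨a, ha.trans hxy, ht⟩

theorem lowerExtension_coe {S T : Type*} [Preorder S] [Preorder T] {A : Set S} {f : A → T}
    (hf : Monotone f) (a : A) : lowerExtension A f a = LowerSet.Iic (f a) := by
  ext t
  exact ⟨fun ⟨b, hb, ht⟩ => ht.trans (hf hb), fun ht => ⟨a, le_rfl, ht⟩⟩

/-- If `t` lies below `f a` and `f b` with `a ≤ x` and `b ≤ y`, then `a ⊓ b` witnesses membership at
`x ⊓ y`. -/
theorem lowerExtension_inf {S T : Type*} [SemilatticeInf S] [SemilatticeInf T] {A : Set S}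
    (hA : ∀ a ∈ A, ∀ b ∈ A, a ⊓ b ∈ A) {f : A → T}
    (hf : ∀ a b : A, f ⟨a ⊓ b, hA a a.2 b b.2⟩ = f a ⊓ f b) (x y : S) :
    lowerExtension A f (x ⊓ y) = lowerExtension A f x ⊓ lowerExtension A f y := by
  refine le_antisymm (le_inf (lowerExtension_mono A f inf_le_left)
    (lowerExtension_mono A f inf_le_right)) ?_
  rintro t ⟨⟨a, ha, hta⟩, ⟨b, hb, htb⟩⟩
  refine ⟨⟨a ⊓ b, hA a a.2 b b.2⟩, inf_le_inf ha hb, ?_⟩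
  rw [hf]
  exact le_inf hta htb

/-- `T` embeds in `LowerSet T` by principal lower sets. A point with nothing of `A` below it goes to
the empty lower set. -/
theorem isHomomorphismHomogeneous_poset (P : Type w) [Language.order.Structure P] [Countable P]
    (hP : IsFraisseLimit finitePosets.{w} P) : IsHomomorphismHomogeneous Language.order P := by
  refine isHomomorphismHomogeneous_of_isFraisseLimit hP ?_
  rintro ⟨S, sS⟩ ⟨_, pS, hS⟩ ⟨T, sT⟩ ⟨hT, pT, hT'⟩ A - - f
  change Finite T at hT
  change PartialOrder S at pS
  change PartialOrder T at pT
  change sS = @Language.orderStructure S pS.toLE at hS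
  change sT = @Language.orderStructure T pT.toLE at hT'
  subst hS hT'
  let := @Language.orderStructure S pS.toLE
  let := @Language.orderStructure T pT.toLE
  let := Language.orderStructure (LowerSet T)
  have hf : Monotone f := fun a b hab => f.map_rel orderRel.le ![a, b] hab
  refine ⟨⟨LowerSet T, inferInstance⟩, ⟨inferInstanceAs (Finite (LowerSet T)), inferInstance, rfl⟩,
    ⟨⟨LowerSet.Iic, LowerSet.Iic_injective⟩, (nomatch ·), ?_⟩,
    ⟨lowerExtension (A : Set S) f, (nomatch ·), ?_⟩, lowerExtension_coe hf⟩
  · rintro _ ⟨⟩ x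
    exact LowerSet.Iic_le
  · rintro _ ⟨⟩ x hx
    exact lowerExtension_mono (A : Set S) f hx

theorem isHomomorphismHomogeneous_semilattice (Ω : Type w) [semilatticeLanguage.Structure Ω]
    [Countable Ω] (hΩ : IsFraisseLimit finiteSemilattices.{w} Ω) :
    IsHomomorphismHomogeneous semilatticeLanguage Ω := by
  refine isHomomorphismHomogeneous_of_isFraisseLimit hΩ ?_
  rintro ⟨S, sS⟩ ⟨_, pS, hS⟩ ⟨T, sT⟩ ⟨hT, pT, hT'⟩ A - - f
  change Finite T at hT
  change SemilatticeInf S at pS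
  change SemilatticeInf T at pT
  change sS = semilatticeStructure S pS at hS
  change sT = semilatticeStructure T pT at hT'
  subst hS hT'
  let := semilatticeStructure S pS
  let := semilatticeStructure T pT
  let := semilatticeStructure (LowerSet T) inferInstance
  have hA : ∀ a ∈ (A : Set S), ∀ b ∈ (A : Set S), a ⊓ b ∈ (A : Set S) := fun a ha b hb =>
    A.fun_mem SemilatticeFunc.inf ![a, b] (Fin.forall_fin_two.2 ⟨ha, hb⟩)
  have hinf : ∀ a b : A, f ⟨a ⊓ b, hA a a.2 b b.2⟩ = f a ⊓ f b := fun a b =>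
    f.map_fun SemilatticeFunc.inf ![a, b]
  have hf : Monotone f := fun a b (hab : (a : S) ≤ b) => by
    rw [← inf_eq_left, ← hinf]
    exact congrArg f (Subtype.ext (inf_eq_left.2 hab))
  refine ⟨⟨LowerSet T, inferInstance⟩, ⟨inferInstanceAs (Finite (LowerSet T)), inferInstance, rfl⟩,
    ⟨⟨LowerSet.Iic, LowerSet.Iic_injective⟩, ?_, (nomatch ·)⟩,
    ⟨lowerExtension (A : Set S) f, ?_, (nomatch ·)⟩, lowerExtension_coe hf⟩
  · rintro _ ⟨⟩ x
    exact LowerSet.Iic_inf _ _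
  · rintro _ ⟨⟩ x
    exact lowerExtension_inf hA hinf _ _

/-! ### Distributive lattices and Boolean algebras -/

/-- `Prop`, as a lattice, is injective among distributive lattices. -/
theorem exists_latticeHom_prop_extension {S : Type*} [DistribLattice S] (A : Sublattice S)
    (f : LatticeHom A Prop) : ∃ g : LatticeHom S Prop, ∀ a : A, g a = f a := by
  -- Constant `f`, including the case of empty `A`, is set aside so that the ideal and the filter
  -- below are nonempty.
  by_cases h1 : ∀ a, f a
  · exact ⟨⟨⟨fun _ => True, by simp⟩, by simp⟩, fun a => (eq_true (h1 a)).symm⟩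
  by_cases h0 : ∀ a, ¬ f a
  · exact ⟨⟨⟨fun _ => False, by simp⟩, by simp⟩, fun a => (eq_false (h0 a)).symm⟩
  push Not at h0 h1
  obtain ⟨a₁, ha₁⟩ := h0
  obtain ⟨a₀, ha₀⟩ := h1
  let I : Order.Ideal S :=
    { carrier := {x | ∃ a : A, ¬ f a ∧ x ≤ a}
      lower' := fun _ _ hxy ⟨a, ha, h⟩ => ⟨a, ha, hxy.trans h⟩
      nonempty' := ⟨a₀, a₀, ha₀, le_rfl⟩
      directed' := by
        rintro x ⟨a, ha, hx⟩ y ⟨b, hb, hy⟩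
        refine ⟨a ⊔ b, ⟨a ⊔ b, ?_, le_rfl⟩, le_sup_of_le_left hx, le_sup_of_le_right hy⟩
        rw [SupHomClass.map_sup]
        exact fun h => h.elim ha hb }
  have hF : Order.IsPFilter {x : S | ∃ a : A, f a ∧ (a : S) ≤ x} := by
    refine Order.IsPFilter.of_def ⟨a₁, a₁, ha₁, le_rfl⟩ ?_ ?_
    · rintro x ⟨a, ha, hx⟩ y ⟨b, hb, hy⟩
      refine ⟨a ⊓ b, ⟨a ⊓ b, ?_, le_rfl⟩, inf_le_of_left_le hx, inf_le_of_right_le hy⟩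
      rw [InfHomClass.map_inf]
      exact ⟨ha, hb⟩
    · rintro x y hxy ⟨a, ha, h⟩
      exact ⟨a, ha, h.trans hxy⟩
  -- A common point would give `a ≤ b` with `f a` true and `f b` false. A prime ideal `J` separating
  -- the two then yields the extension `x ∉ J`.
  have hdisj : Disjoint (hF.toPFilter : Set S) (I : Set S) := by
    rw [Set.disjoint_left]
    rintro x ⟨a, ha, hax⟩ ⟨b, hb, hxb⟩
    exact hb (OrderHomClass.mono f (show a ≤ b from hax.trans hxb) ha)
  obtain ⟨J, hJ, hIJ, hFJ⟩ := DistribLattice.prime_ideal_of_disjoint_filter_ideal hdisj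
  refine ⟨⟨⟨fun x => x ∉ J, fun x y => ?_⟩, fun x y => ?_⟩,
    fun a => propext ⟨fun h => ?_, fun h => ?_⟩⟩
  · simp only [Order.Ideal.sup_mem_iff, sup_Prop_eq]
    exact propext not_and_or
  · simp only [inf_Prop_eq, ← not_or]
    exact congrArg Not (propext ⟨hJ.mem_or_mem,
      fun h => h.elim (J.lower inf_le_left) (J.lower inf_le_right)⟩)
  · by_contra ha
    exact h (hIJ ⟨a, ha, le_rfl⟩)
  · exact Set.disjoint_left.1 hFJ ⟨a, h, le_rfl⟩

theorem exists_latticeHom_prop_of_not_le {S : Type*} [DistribLattice S] {a b : S} (hab : ¬ a ≤ b) :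
    ∃ g : LatticeHom S Prop, g a ∧ ¬ g b := by
  let A : Sublattice S :=
    { carrier := {x | x = a ∨ x = a ⊓ b}
      supClosed' := by rintro x (rfl | rfl) y (rfl | rfl) <;> simp
      infClosed' := by rintro x (rfl | rfl) y (rfl | rfl) <;> simp }
  have hne : a ⊓ b ≠ a := fun h => hab (inf_eq_left.1 h)
  -- On the two-element chain `a ⊓ b < a`, send only `a` to true; the extension cannot be true at
  -- `b`.
  obtain ⟨g, hg⟩ := exists_latticeHom_prop_extension A
    ⟨⟨fun x => (x : S) = a, by
      rintro ⟨x, rfl | rfl⟩ ⟨y, rfl | rfl⟩ <;> simp [hne]⟩, by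
      rintro ⟨x, rfl | rfl⟩ ⟨y, rfl | rfl⟩ <;> simp [hne]⟩
  have ha : g a := (hg ⟨a, Or.inl rfl⟩).mpr rfl
  refine ⟨g, ha, fun hb => hne ?_⟩
  refine (hg ⟨a ⊓ b, Or.inr rfl⟩).mp ?_
  change g (a ⊓ b)
  rw [InfHomClass.map_inf]
  exact ⟨ha, hb⟩

theorem exists_latticeHom_prop_ne {S : Type*} [DistribLattice S] {a b : S} (hab : a ≠ b) :
    ∃ g : LatticeHom S Prop, g a ≠ g b := by
  rcases not_and_or.1 fun h => hab (le_antisymm h.1 h.2) with h | h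
  · obtain ⟨g, ha, hb⟩ := exists_latticeHom_prop_of_not_le h
    exact ⟨g, fun h => hb (h.mp ha)⟩
  · obtain ⟨g, ha, hb⟩ := exists_latticeHom_prop_of_not_le h
    exact ⟨g, fun h => hb (h.mpr ha)⟩

theorem isHomomorphismHomogeneous_distribLattice (D : Type w) [latticeLanguage.Structure D]
    [Countable D] (hD : IsFraisseLimit finiteDistribLattices.{w} D) :
    IsHomomorphismHomogeneous latticeLanguage D := by
  refine isHomomorphismHomogeneous_of_isFraisseLimit hD ?_
  rintro ⟨S, sS⟩ ⟨_, pS, hS⟩ ⟨T, sT⟩ ⟨hT, pT, hT'⟩ A - - f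
  change Finite T at hT
  change DistribLattice S at pS
  change DistribLattice T at pT
  change sS = latticeStructure S pS.toLattice at hS
  change sT = latticeStructure T pT.toLattice at hT'
  subst hS hT'
  let := latticeStructure S pS.toLattice
  let := latticeStructure T pT.toLattice
  let := latticeStructure (Set (LatticeHom T Prop)) inferInstance
  let A' : Sublattice S :=
    { carrier := A
      supClosed' := fun a ha b hb =>
        A.fun_mem LatticeFunc.sup ![a, b] (Fin.forall_fin_two.2 ⟨ha, hb⟩)
      infClosed' := fun a ha b hb =>
        A.fun_mem LatticeFunc.inf ![a, b] (Fin.forall_fin_two.2 ⟨ha, hb⟩) }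
  let f' : LatticeHom A' T :=
    ⟨⟨f, fun a b => f.map_fun LatticeFunc.sup ![a, b]⟩,
      fun a b => f.map_fun LatticeFunc.inf ![a, b]⟩
  -- `T` embeds in the power set by evaluation, and `e h` is the coordinate at `h` of the map from
  -- `S`.
  choose e he using fun h : LatticeHom T Prop => exists_latticeHom_prop_extension A' (h.comp f')
  have : Finite (LatticeHom T Prop) := Finite.of_injective _ DFunLike.coe_injective
  refine ⟨⟨Set (LatticeHom T Prop), inferInstance⟩,
    ⟨inferInstanceAs (Finite (Set (LatticeHom T Prop))), inferInstance, rfl⟩,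
    ⟨⟨fun t => {h | h t}, fun s t hst => ?_⟩, ?_, (nomatch ·)⟩,
    ⟨fun x => {h | e h x}, ?_, (nomatch ·)⟩, fun a => Set.ext fun h => iff_of_eq (he h a)⟩
  · by_contra hne
    obtain ⟨g, hg⟩ := exists_latticeHom_prop_ne hne
    exact hg (congrArg (g ∈ ·) hst)
  · rintro _ ⟨⟩ x
    · exact Set.ext fun h => iff_of_eq (SupHomClass.map_sup h (x 0) (x 1))
    · exact Set.ext fun h => iff_of_eq (InfHomClass.map_inf h (x 0) (x 1))
  · rintro _ ⟨⟩ x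
    · exact Set.ext fun h => iff_of_eq (SupHomClass.map_sup (e h) (x 0) (x 1))
    · exact Set.ext fun h => iff_of_eq (InfHomClass.map_inf (e h) (x 0) (x 1))

theorem isHomomorphismHomogeneous_booleanAlgebra (D : Type w) [booleanLanguage.Structure D]
    [Countable D] (hD : IsFraisseLimit finiteBooleanAlgebras.{w} D) :
    IsHomomorphismHomogeneous booleanLanguage D := by
  refine isHomomorphismHomogeneous_of_isFraisseLimit hD ?_
  rintro ⟨S, sS⟩ ⟨_, nS, pS, hS⟩ ⟨T, sT⟩ ⟨hT, nT, pT, hT'⟩ A - - f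
  change Finite T at hT
  change Nontrivial T at nT
  change BooleanAlgebra S at pS
  change BooleanAlgebra T at pT
  change sS = booleanStructure S pS at hS
  change sT = booleanStructure T pT at hT'
  subst hS hT'
  let := booleanStructure S pS
  let := booleanStructure T pT
  let := booleanStructure (Set (BoundedLatticeHom T Prop)) inferInstance
  let A' : Sublattice S :=
    { carrier := A
      supClosed' := fun a ha b hb =>
        A.fun_mem BooleanFunc.sup ![a, b] (Fin.forall_fin_two.2 ⟨ha, hb⟩)
      infClosed' := fun a ha b hb =>
        A.fun_mem BooleanFunc.inf ![a, b] (Fin.forall_fin_two.2 ⟨ha, hb⟩) }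
  let f' : LatticeHom A' T :=
    ⟨⟨f, fun a b => f.map_fun BooleanFunc.sup ![a, b]⟩,
      fun a b => f.map_fun BooleanFunc.inf ![a, b]⟩
  have hbot : (⊥ : S) ∈ A' := A.fun_mem BooleanFunc.bot ![] fun i => i.elim0
  have htop : (⊤ : S) ∈ A' := A.fun_mem BooleanFunc.top ![] fun i => i.elim0
  have fbot : f' ⟨⊥, hbot⟩ = ⊥ :=
    (congrArg f (Subtype.ext rfl)).trans (f.map_fun BooleanFunc.bot ![])
  have ftop : f' ⟨⊤, htop⟩ = ⊤ :=
    (congrArg f (Subtype.ext rfl)).trans (f.map_fun BooleanFunc.top ![])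
  have ext : ∀ h : BoundedLatticeHom T Prop, ∃ e : BoundedLatticeHom S Prop,
      ∀ a : A', e a = h (f' a) := by
    intro h
    obtain ⟨e, he⟩ := exists_latticeHom_prop_extension A' (h.toLatticeHom.comp f')
    refine ⟨⟨e, ?_, ?_⟩, he⟩
    · exact (he ⟨⊤, htop⟩).trans ((congrArg h ftop).trans (map_top h))
    · exact (he ⟨⊥, hbot⟩).trans ((congrArg h fbot).trans (map_bot h))
  choose e he using ext
  have sep : ∀ s t : T, s ≠ t → ∃ h : BoundedLatticeHom T Prop, h s ≠ h t := by
    intro s t hst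
    -- A separating homomorphism is not constant, so by monotonicity it preserves both bounds.
    obtain ⟨g, hg⟩ := exists_latticeHom_prop_ne hst
    refine ⟨⟨g, ?_, ?_⟩, hg⟩
    · refine eq_true (by_contra fun h => hg (propext ⟨fun h' => ?_, fun h' => ?_⟩))
      · exact (h (OrderHomClass.mono g le_top h')).elim
      · exact (h (OrderHomClass.mono g le_top h')).elim
    · refine eq_false fun h => hg (propext ⟨fun _ => ?_, fun _ => ?_⟩)
      · exact OrderHomClass.mono g bot_le h
      · exact OrderHomClass.mono g bot_le h
  have : Finite (BoundedLatticeHom T Prop) := Finite.of_injective _ DFunLike.coe_injective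
  -- This makes the power set nontrivial, as membership in the class requires.
  have : Nonempty (BoundedLatticeHom T Prop) :=
    let ⟨s, t, hst⟩ := exists_pair_ne T
    ⟨(sep s t hst).choose⟩
  refine ⟨⟨Set (BoundedLatticeHom T Prop), inferInstance⟩,
    ⟨inferInstanceAs (Finite (Set (BoundedLatticeHom T Prop))),
      inferInstanceAs (Nontrivial (Set (BoundedLatticeHom T Prop))), inferInstance, rfl⟩,
    ⟨⟨fun t => {h | h t}, fun s t hst => ?_⟩, ?_, (nomatch ·)⟩,
    ⟨fun x => {h | e h x}, ?_, (nomatch ·)⟩, fun a => Set.ext fun h => iff_of_eq (he h a)⟩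
  · by_contra hne
    obtain ⟨g, hg⟩ := sep s t hne
    exact hg (congrArg (g ∈ ·) hst)
  · rintro _ ⟨⟩ x
    · exact Set.ext fun h => iff_of_eq (SupHomClass.map_sup h (x 0) (x 1))
    · exact Set.ext fun h => iff_of_eq (InfHomClass.map_inf h (x 0) (x 1))
    · exact Set.ext fun h => iff_of_eq (map_compl' h (x 0))
    · exact Set.ext fun h => iff_of_eq (map_bot h)
    · exact Set.ext fun h => iff_of_eq (map_top h)
  · rintro _ ⟨⟩ x
    · exact Set.ext fun h => iff_of_eq (SupHomClass.map_sup (e h) (x 0) (x 1))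
    · exact Set.ext fun h => iff_of_eq (InfHomClass.map_inf (e h) (x 0) (x 1))
    · exact Set.ext fun h => iff_of_eq (map_compl' (e h) (x 0))
    · exact Set.ext fun h => iff_of_eq (map_bot (e h))
    · exact Set.ext fun h => iff_of_eq (map_top (e h))

/-! ### Vector spaces -/

/-- Substructures are subspaces and homomorphisms are linear maps, which extend from any subspace.
-/
theorem isHomomorphismHomogeneous_vectorSpace (F : Type u) (V : Type w) [Field F] [AddCommGroup V]
    [Module F V] : @IsHomomorphismHomogeneous (vectorLanguage F) V (vectorStructure F V) := by
  let := vectorStructure F V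
  intro B C _ _ φ
  let B' : Submodule F V :=
    { carrier := B
      add_mem' := fun {a b} ha hb =>
        B.fun_mem VectorFunc.add ![a, b] (Fin.forall_fin_two.2 ⟨ha, hb⟩)
      zero_mem' := B.fun_mem VectorFunc.zero ![] fun i => i.elim0
      smul_mem' := fun c a ha => B.fun_mem (VectorFunc.smul c) ![a] (Fin.forall_fin_one.2 ha) }
  let f : B' →ₗ[F] V :=
    { toFun := fun b => φ b
      map_add' := fun a b => congrArg Subtype.val (φ.map_fun VectorFunc.add ![a, b])
      map_smul' := fun c a => congrArg Subtype.val (φ.map_fun (VectorFunc.smul c) ![a]) }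
  obtain ⟨g, hg⟩ := f.exists_extend
  refine ⟨⟨g, ?_, (nomatch ·)⟩, fun b => LinearMap.congr_fun hg b⟩
  rintro _ ⟨⟩ x
  · exact map_add g _ _
  · exact map_neg g _
  · exact map_zero g
  · exact map_smul g _ _

end HomHom

theorem mainTheorem5 :
    -- the random graph
    (∀ (R : Type w) [FirstOrder.Language.graph.Structure R] [Countable R],
      FirstOrder.Language.IsFraisseLimit HomHom.finiteGraphs.{w} R →
        HomHom.IsHomomorphismHomogeneous FirstOrder.Language.graph R) ∧
    -- the complements of the Henson graphs
    (∀ (n : ℕ), 3 ≤ n → ∀ (V : Type w) [Countable V] (H : SimpleGraph V),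
      @FirstOrder.Language.IsFraisseLimit FirstOrder.Language.graph (HomHom.finiteCliqueFreeGraphs.{w} n) V
          H.structure _ _ →
        @HomHom.IsHomomorphismHomogeneous FirstOrder.Language.graph V Hᶜ.structure) ∧
    -- the rational Urysohn space
    (∀ (U : Type w) [HomHom.metricLanguage.Structure U] [Countable U],
      FirstOrder.Language.IsFraisseLimit HomHom.finiteRationalMetricSpaces.{w} U →
        HomHom.IsHomomorphismHomogeneous HomHom.metricLanguage U) ∧
    -- the generic poset
    (∀ (P : Type w) [FirstOrder.Language.order.Structure P] [Countable P],
      FirstOrder.Language.IsFraisseLimit HomHom.finitePosets.{w} P →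
        HomHom.IsHomomorphismHomogeneous FirstOrder.Language.order P) ∧
    -- the countable universal ultrahomogeneous semilattice
    (∀ (Ω : Type w) [HomHom.semilatticeLanguage.Structure Ω] [Countable Ω],
      FirstOrder.Language.IsFraisseLimit HomHom.finiteSemilattices.{w} Ω →
        HomHom.IsHomomorphismHomogeneous HomHom.semilatticeLanguage Ω) ∧
    -- the countable universal ultrahomogeneous distributive lattice
    (∀ (D : Type w) [HomHom.latticeLanguage.Structure D] [Countable D],
      FirstOrder.Language.IsFraisseLimit HomHom.finiteDistribLattices.{w} D →
        HomHom.IsHomomorphismHomogeneous HomHom.latticeLanguage D) ∧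
    -- the countable atomless Boolean algebra
    (∀ (A : Type w) [HomHom.booleanLanguage.Structure A] [Countable A],
      FirstOrder.Language.IsFraisseLimit HomHom.finiteBooleanAlgebras.{w} A →
        HomHom.IsHomomorphismHomogeneous HomHom.booleanLanguage A) ∧
    -- the vector space of countably infinite dimension over an arbitrary field
    (∀ (F : Type u) (V : Type w) [Field F] [AddCommGroup V] [Module F V],
      Module.rank F V = ℵ₀ →
        @HomHom.IsHomomorphismHomogeneous (HomHom.vectorLanguage F) V
          (HomHom.vectorStructure F V)) := by
  exact
    ⟨fun R => HomHom.isHomomorphismHomogeneous_randomGraph R,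
      HomHom.isHomomorphismHomogeneous_compl_henson,
      fun U => HomHom.isHomomorphismHomogeneous_urysohn U,
      fun P => HomHom.isHomomorphismHomogeneous_poset P,
      fun Ω => HomHom.isHomomorphismHomogeneous_semilattice Ω,
      fun D => HomHom.isHomomorphismHomogeneous_distribLattice D,
      fun A => HomHom.isHomomorphismHomogeneous_booleanAlgebra A,
      fun F V _ _ _ _ => HomHom.isHomomorphismHomogeneous_vectorSpace F V⟩
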